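/- Let $n\ge 1$ be an integer and let $p$ be a prime. Let $\mathcal{L}_{n,p}=(\mathbb{Z}/p\mathbb{Z})^n\wr\mathbb{Z}=\bigl(\bigoplus_{\mathbb{Z}}(\mathbb{Z}/p\mathbb{Z})^n\bigr)\rtimes\mathbb{Z}$ be the lamplighter group, where $\mathbb{Z}$ acts by shifting coordinates, and let $\mathcal{A}_{n,p}=\bigoplus_{\mathbb{Z}}(\mathbb{Z}/p\mathbb{Z})^n$, viewed as a subgroup of $\mathcal{L}_{n,p}$. For a countable discrete group $G$ let $\mathrm{Sub}(G)$ be the set of all subgroups of $G$ with the topology induced from the product topology on $\{0,1\}^G$, a subgroup being identified with its indicator function. For a topological space $X$ put $X^0=X$; let $X^{\alpha+1}$ be the set of limit points of $X^{\alpha}$ in $X^{\alpha}$, for each ordinal $\alpha$, and $X^{\lambda}=\bigcap_{\alpha<\lambda}X^{\alpha}$ for limit ordinals $\lambda$. The Cantor–Bendixson rank of $X$ is the least ordinal $\alpha_\star$ such that $X^{\alpha}=X^{\alpha_\star}$ for all $\alpha\ge\alpha_\star$, and the perfect kernel of $X$ is $X^{\alpha_\star}$. Then the perfect kernel of $\mathrm{Sub}(\mathcal{L}_{n,p})$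 is $\mathrm{Sub}(\mathcal{A}_{n,p})$, that is, the set of all subgroups of $\mathcal{L}_{n,p}$ that are contained in $\mathcal{A}_{n,p}$. Moreover, the Cantor–Bendixson rank of $\mathrm{Sub}(\mathcal{L}_{n,p})$ is $\omega$, the first infinite ordinal. -/

import Mathlib

/-- The space `Sub(G)` of all subgroups of a discrete group `G`: the topology induced by the
product topology of `{0,1}^G` (with `{0,1} = Bool` discrete), a subgroup being identified with its
indicator function. -/
noncomputable instance Subgroup.chabautyTopology (G : Type*) [Group G] :
    TopologicalSpace (Subgroup G) :=
  open Classical in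
  TopologicalSpace.induced (fun (H : Subgroup G) (g : G) => decide (g ∈ H)) inferInstance

/-- The Cantor–Bendixson rank of a topological space `X`: the least ordinal `a` such that
the iterated Cantor–Bendixson derivatives satisfy `X^b = X^a` for all `b ≥ a`. -/
noncomputable def cantorBendixsonRank (X : Type*) [TopologicalSpace X] : Ordinal :=
  sInf {a | ∀ b, a ≤ b → CantorBendixson.iteratedDerivedSet (Set.univ : Set X) b =
    CantorBendixson.iteratedDerivedSet (Set.univ : Set X) a}

/-- The infimum in the definition of the rank is attained. -/
theorem isLeast_cantorBendixsonRank (X : Type*) [TopologicalSpace X] :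
    IsLeast {a | ∀ b, a ≤ b → CantorBendixson.iteratedDerivedSet (Set.univ : Set X) b =
      CantorBendixson.iteratedDerivedSet (Set.univ : Set X) a} (cantorBendixsonRank X) := by
  refine ⟨csInf_mem ?_, fun a ha => csInf_le' ha⟩
  obtain ⟨a, ha⟩ := CantorBendixson.iteratedDerivedSet_mem_fixedPoints (Set.univ : Set X)
  refine ⟨a, fun b hb => ?_⟩
  refine (CantorBendixson.iteratedDerivedSet_antitone _ hb).antisymm ?_
  rw [← CantorBendixson.perfectKernel_eq_iteratedDerivedSet_of_mem_fixedPoints ha]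
  exact CantorBendixson.perfectKernel_subset_iteratedDerivedSet _ b

/-- The direct sum `⨁_ℤ (ℤ/pℤ)^n`: finitely supported functions on `ℤ` with values in
`(ℤ/pℤ)^n`. -/
abbrev LampConfig (n p : ℕ) : Type := ℤ →₀ (Fin n → ZMod p)

/-- The action of `ℤ` on `⨁_ℤ (ℤ/pℤ)^n` by shifts: `(s • ω)_i = ω_{i+s}`. Both groups are written
multiplicatively. -/
noncomputable def lampShift (n p : ℕ) :
    Multiplicative ℤ →* MulAut (Multiplicative (LampConfig n p)) where
  toFun s := AddEquiv.toMultiplicative (Finsupp.domCongr (Equiv.subRight s.toAdd))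
  map_one' := by
    ext ω : 1
    apply Multiplicative.toAdd.injective
    ext i : 1
    exact congrArg (ω.toAdd : ℤ → Fin n → ZMod p) (add_zero i)
  map_mul' s t := by
    ext ω : 1
    apply Multiplicative.toAdd.injective
    ext i : 1
    exact congrArg (ω.toAdd : ℤ → Fin n → ZMod p) (add_assoc i s.toAdd t.toAdd).symm

theorem lampShift_apply (n p : ℕ) (s : Multiplicative ℤ) (ω : Multiplicative (LampConfig n p))
    (i : ℤ) : (lampShift n p s ω).toAdd i = ω.toAdd (i + s.toAdd) := rfl

/-- The lamplighter group `(ℤ/pℤ)^n ≀ ℤ = ⨁_ℤ (ℤ/pℤ)^n ⋊ ℤ`. -/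
abbrev Lamplighter (n p : ℕ) : Type :=
  Multiplicative (LampConfig n p) ⋊[lampShift n p] Multiplicative ℤ

/-- The subgroup `⨁_ℤ (ℤ/pℤ)^n` of the lamplighter group. -/
noncomputable def Lamplighter.base (n p : ℕ) : Subgroup (Lamplighter n p) :=
  (SemidirectProduct.inl : Multiplicative (LampConfig n p) →* Lamplighter n p).range

/-! A subgroup `H` outside the base contains some `mk v k` with `k > 0`, so its configurations form
a group `B` invariant under translation by `k`. Like leading coefficients of an ideal,
`extremeValues k B` records how elements of `B` can end on either side; it lies in a finite set. A
subgroup `K` close to `H` contains `mk v k` and representatives of all these values. If `K` has no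
further ones, reduction from both ends brings every comparison into a finite window and forces `K =
H` (`exists_finset_extremeValues_ssubset`). Each derivative thus costs at least one of finitely many
values, and `H` disappears at a finite stage.

The subgroups of the base survive all derivatives, because a neighbourhood sees only a finite window
(`preperfect_subgroups_of_base`). Hence stage `ω` is exactly this set. No finite stage suffices:
vanishing on a residue class is a limit of zero-sum conditions along ever larger moduli, and each
residue class yields one derivative (`extension_zeroSumConfigs_mem_iteratedDerivedSet`). -/

/-! ### Neighbourhoods and limit points in the space of subgroups. -/

section SubgroupTopology

variable {G : Type*} [Group G]

theorem Subgroup.mem_nhds_iff_exists_finset {H : Subgroup G} {U : Set (Subgroup G)} :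
    U ∈ nhds H ↔ ∃ F : Finset G, {K : Subgroup G | ∀ x ∈ F, x ∈ K ↔ x ∈ H} ⊆ U := by
  classical
  rw [nhds_induced, nhds_pi]
  constructor
  · rintro ⟨S, hS, hSU⟩
    obtain ⟨I, hI, t, ht, hts⟩ := Filter.mem_pi.1 hS
    refine ⟨hI.toFinset, fun K hK => hSU (hts fun x hx => ?_)⟩
    have := mem_of_mem_nhds (ht x)
    convert this using 1
    simpa using hK x (by simpa using hx)
  · rintro ⟨F, hF⟩
    refine ⟨(F : Set G).pi fun x => {decide (x ∈ H)}, ?_, fun K hK => hF fun x hx => ?_⟩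
    · exact Filter.pi_mem_pi F.finite_toSet fun x _ => by simp
    · simpa using hK x hx

theorem Subgroup.accPt_principal_iff {H : Subgroup G} {S : Set (Subgroup G)} :
    AccPt H (Filter.principal S) ↔
      ∀ F : Finset G, ∃ K ∈ S, K ≠ H ∧ ∀ x ∈ F, x ∈ K ↔ x ∈ H := by
  rw [accPt_iff_nhds]
  constructor
  · intro h F
    obtain ⟨K, ⟨hK, hKS⟩, hne⟩ := h _ (Subgroup.mem_nhds_iff_exists_finset.2 ⟨F, subset_rfl⟩)
    exact ⟨K, hKS, hne, hK⟩
  · intro h U hU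
    obtain ⟨F, hF⟩ := Subgroup.mem_nhds_iff_exists_finset.1 hU
    obtain ⟨K, hKS, hne, hK⟩ := h F
    exact ⟨K, ⟨hF hK, hKS⟩, hne⟩

end SubgroupTopology

/-! ### Translation-invariant groups of configurations and reduction modulo them. -/

section Translation

variable {V : Type*} [AddCommGroup V]

/-- Translation of finitely supported functions on `ℤ`: `(shiftBy s ω)_i = ω_{i+s}`. -/
noncomputable def shiftBy (s : ℤ) : (ℤ →₀ V) ≃+ (ℤ →₀ V) :=
  Finsupp.domCongr (Equiv.subRight s)

theorem shiftBy_apply (s : ℤ) (ω : ℤ →₀ V) (i : ℤ) : shiftBy s ω i = ω (i + s) := rfl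

theorem shiftBy_shiftBy (s t : ℤ) (ω : ℤ →₀ V) :
    shiftBy s (shiftBy t ω) = shiftBy (s + t) ω := by
  ext1 i
  simp only [shiftBy_apply]
  congr 1
  ring

theorem shiftBy_zero (ω : ℤ →₀ V) : shiftBy 0 ω = ω := by
  ext1 i
  simp [shiftBy_apply]

/-- Invariance of a group of configurations under translation by `k` and by `-k`. -/
def TranslateInvariant (k : ℤ) (B : AddSubgroup (ℤ →₀ V)) : Prop :=
  ∀ ω, shiftBy k ω ∈ B ↔ ω ∈ B

theorem TranslateInvariant.mul {k : ℤ} {B : AddSubgroup (ℤ →₀ V)} (h : TranslateInvariant k B)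
    (q : ℤ) : TranslateInvariant (k * q) B := by
  induction q using Int.induction_on with
  | zero => intro ω; simp [shiftBy_zero]
  | succ i ih =>
    intro ω
    rw [mul_add, mul_one, ← shiftBy_shiftBy, ih, h]
  | pred i ih =>
    intro ω
    rw [← h (shiftBy _ ω), shiftBy_shiftBy, show k + k * (-(i : ℤ) - 1) = k * -i by ring, ih]

theorem TranslateInvariant.inf {k : ℤ} {B C : AddSubgroup (ℤ →₀ V)} (hB : TranslateInvariant k B)
    (hC : TranslateInvariant k C) : TranslateInvariant k (B ⊓ C) := fun ω => by
  simp only [AddSubgroup.mem_inf, hB ω, hC ω]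

/-- The values `a` that elements of `B` take at their last (`ε = 1`) or first (`ε = -1`) possible
site, that site being one of `0, …, k - 1`. -/
def extremeValues (k : ℕ) (B : AddSubgroup (ℤ →₀ V)) : Set (ℤˣ × Fin k × V) :=
  {x | ∃ ω ∈ B, ω ((x.2.1 : ℕ) : ℤ) = x.2.2 ∧
    ∀ i : ℤ, 0 < (x.1 : ℤ) * (i - ((x.2.1 : ℕ) : ℤ)) → ω i = 0}

/-- Configurations vanishing outside `[-E, E]`. -/
def windowed (V : Type*) [AddCommGroup V] (E : ℕ) : AddSubgroup (ℤ →₀ V) where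
  carrier := {ω | ∀ i : ℤ, (E : ℤ) < |i| → ω i = 0}
  zero_mem' := by simp
  add_mem' {a b} ha hb i hi := by simp [ha i hi, hb i hi]
  neg_mem' {a} ha i hi := by simp [ha i hi]

theorem windowed_mono {D E : ℕ} (h : D ≤ E) : windowed V D ≤ windowed V E :=
  fun _ hω i hi => hω i (lt_of_le_of_lt (by exact_mod_cast h) hi)

theorem exists_mem_windowed (ω : ℤ →₀ V) : ∃ E, ω ∈ windowed V E := by
  refine ⟨ω.support.sup Int.natAbs, fun i hi => ?_⟩
  by_contra h
  have := Finset.le_sup (f := Int.natAbs) (Finsupp.mem_support_iff.2 h)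
  rw [Int.abs_eq_natAbs] at hi
  exact absurd hi (by exact_mod_cast this.not_gt)

theorem exists_forall_mem_windowed (F : Finset (ℤ →₀ V)) : ∃ E, ∀ ω ∈ F, ω ∈ windowed V E := by
  choose E hE using exists_mem_windowed (V := V)
  exact ⟨F.sup E, fun ω hω => windowed_mono (Finset.le_sup hω) (hE ω)⟩

theorem finite_windowed [Finite V] (E : ℕ) : (windowed V E : Set (ℤ →₀ V)).Finite := by
  classical
  have := Fintype.ofFinite V
  refine ((Finset.Icc (-E : ℤ) E).finsupp fun _ => (Finset.univ : Finset V)).finite_toSet.subset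
    fun ω hω => ?_
  rw [Finset.mem_coe, Finset.mem_finsupp_iff]
  refine ⟨fun i hi => ?_, fun _ _ => Finset.mem_univ _⟩
  rw [Finset.mem_Icc, ← abs_le]
  by_contra h
  exact Finsupp.mem_support_iff.1 hi (hω i (not_le.1 h))

theorem exists_extreme_representatives [Finite V] (k : ℕ) (B : AddSubgroup (ℤ →₀ V)) :
    ∃ F : Finset (ℤ →₀ V), ∀ x ∈ extremeValues k B, ∃ ω ∈ F, ω ∈ B ∧
      ω ((x.2.1 : ℕ) : ℤ) = x.2.2 ∧
        ∀ i : ℤ, 0 < (x.1 : ℤ) * (i - ((x.2.1 : ℕ) : ℤ)) → ω i = 0 := by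
  classical
  choose f hf using fun x : extremeValues k B => x.2
  exact ⟨(Set.toFinite (Set.range f)).toFinset, fun x hx =>
    ⟨f ⟨x, hx⟩, by simp, (hf ⟨x, hx⟩).1, (hf ⟨x, hx⟩).2⟩⟩

/-- One-sided reduction of the elements of `C` modulo `B`, with room to spare on the other side. -/
theorem exists_reduction_one_side {k : ℕ} (hk : 0 < k) {B C : AddSubgroup (ℤ →₀ V)} (hBC : B ≤ C)
    (hB : TranslateInvariant k B) {D : ℕ} (ε : ℤˣ)
    (hC : ∀ x ∈ extremeValues k C, ∃ ω ∈ windowed V D, ω ∈ B ∧ ω ((x.2.1 : ℕ) : ℤ) = x.2.2 ∧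
      ∀ i : ℤ, 0 < (x.1 : ℤ) * (i - ((x.2.1 : ℕ) : ℤ)) → ω i = 0)
    (hC' : TranslateInvariant k C) (M m : ℕ) {x : ℤ →₀ V} (hx : x ∈ C)
    (h₁ : ∀ i : ℤ, (D + k + m : ℤ) < ε * i → x i = 0)
    (h₂ : ∀ i : ℤ, (ε : ℤ) * i < -M → x i = 0) :
    ∃ y ∈ C, x - y ∈ B ∧ (∀ i : ℤ, (D + k : ℤ) < ε * i → y i = 0) ∧
      ∀ i : ℤ, (ε : ℤ) * i < -M → y i = 0 := by
  induction m generalizing x with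
  | zero => exact ⟨x, hx, by simp, by simpa using h₁, h₂⟩
  | succ m ih =>
    obtain ⟨j, hj⟩ : ∃ j : ℤ, (ε : ℤ) * j = D + k + m + 1 := by
      refine ⟨ε * (D + k + m + 1), ?_⟩
      rw [← mul_assoc]
      rcases Int.units_eq_one_or ε with rfl | rfl <;> simp
    have hk' : (0 : ℤ) < k := by exact_mod_cast hk
    obtain ⟨s, hs⟩ : ∃ s : Fin k, ((s : ℕ) : ℤ) = j % k := by
      have h0 := Int.emod_nonneg j hk'.ne'
      have h1 := Int.emod_lt_of_pos j hk'
      exact ⟨⟨(j % k).toNat, by omega⟩, by simp [h0]⟩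
    have hdiv := Int.emod_add_mul_ediv j k
    have hsk : ((s : ℕ) : ℤ) < k := by exact_mod_cast s.2
    obtain ⟨w, hwD, hwB, hws, hw⟩ := hC (ε, s, x j) ⟨shiftBy (k * (j / k)) x, by rwa [hC'.mul],
      by rw [shiftBy_apply, hs, hdiv], fun i hi => by
        rw [shiftBy_apply]
        apply h₁
        simp only at hi
        generalize (k : ℤ) * (j / k) = r at *
        push_cast
        rcases Int.units_eq_one_or ε with rfl | rfl <;> simp at hi hj ⊢ <;> omega⟩
    simp only at hws hw
    have hw' : shiftBy (k * -(j / k)) w ∈ B := by rwa [hB.mul]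
    have hr : (k : ℤ) * -(j / k) = s - j := by rw [mul_neg]; omega
    rw [hr] at hw'
    -- The translate of `w` cancels the value at `j`. It lives within `D` of `j - s`; as `s < k` and
    -- `ε * j > D + k`, this is on the `ε` side of `0`, so the other end is untouched.
    obtain ⟨y, hyC, hyB, hy₁, hy₂⟩ := ih (x := x - shiftBy (s - j) w) (C.sub_mem hx (hBC hw'))
      (fun i hi => by
        rw [Finsupp.sub_apply, shiftBy_apply]
        by_cases hij : i = j
        · subst hij; simp [hws]
        · rw [h₁ i, hw, sub_zero]
          · rcases Int.units_eq_one_or ε with rfl | rfl <;> simp at hi hj ⊢ <;> omega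
          · push_cast
            rcases Int.units_eq_one_or ε with rfl | rfl <;> simp at hi hj ⊢ <;> omega)
      (fun i hi => by
        rw [Finsupp.sub_apply, shiftBy_apply, h₂ i hi, hwD, sub_zero]
        rw [lt_abs]
        rcases Int.units_eq_one_or ε with rfl | rfl <;> simp at hi hj ⊢ <;> omega)
    refine ⟨y, hyC, ?_, hy₁, hy₂⟩
    have := B.add_mem hyB hw'
    rwa [show x - shiftBy (s - j) w - y + shiftBy (s - j) w = x - y by abel] at this

/-- A finite set of representatives: it controls every translation-invariant group with no more
extreme values than `B`, modulo any invariant subgroup that contains enough of `B`. -/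
theorem exists_finite_reduction [Finite V] {k : ℕ} (hk : 0 < k) (B : AddSubgroup (ℤ →₀ V)) :
    ∃ F : Finset (ℤ →₀ V), ∀ B' : AddSubgroup (ℤ →₀ V), (∀ ω ∈ F, ω ∈ B → ω ∈ B') →
      extremeValues k B ⊆ extremeValues k B' ∧
      (TranslateInvariant k B' → ∀ C, B' ≤ C → TranslateInvariant k C →
        extremeValues k C ⊆ extremeValues k B → ∀ x ∈ C, ∃ y ∈ F, y ∈ C ∧ x - y ∈ B') := by
  classical
  obtain ⟨F₀, hF₀⟩ := exists_extreme_representatives k B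
  obtain ⟨D, hD⟩ := exists_forall_mem_windowed F₀
  refine ⟨F₀ ∪ (finite_windowed (V := V) (D + k)).toFinset, fun B' hB' => ⟨fun x hx => ?_,
    fun hinv C hBC hC hsub x hx => ?_⟩⟩
  · obtain ⟨ω, hω, hωB, h⟩ := hF₀ x hx
    exact ⟨ω, hB' ω (by simp [hω]) hωB, h⟩
  · have hrep : ∀ x ∈ extremeValues k C, ∃ ω ∈ windowed V D, ω ∈ B' ∧
        ω ((x.2.1 : ℕ) : ℤ) = x.2.2 ∧
          ∀ i : ℤ, 0 < (x.1 : ℤ) * (i - ((x.2.1 : ℕ) : ℤ)) → ω i = 0 := fun x hx => by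
      obtain ⟨ω, hω, hωB, h⟩ := hF₀ x (hsub hx)
      exact ⟨ω, hD ω hω, hB' ω (by simp [hω]) hωB, h⟩
    obtain ⟨M, hM⟩ := exists_mem_windowed x
    obtain ⟨y, hyC, hyB, hy₁, hy₂⟩ := exists_reduction_one_side hk hBC hinv 1 hrep hC M M hx
      (fun i hi => hM i (by rw [lt_abs]; simp at hi; omega))
      (fun i hi => hM i (by rw [lt_abs]; simp at hi; omega))
    -- After the first reduction `y` lives on `[-M, D + k]`, so the bounds swap roles for the other
    -- end.
    obtain ⟨z, hzC, hzB, hz₁, hz₂⟩ := exists_reduction_one_side hk hBC hinv (-1) hrep hC (D + k) M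
      hyC (fun i hi => hy₂ i (by simp at hi ⊢; omega))
      (fun i hi => hy₁ i (by simp at hi ⊢; omega))
    refine ⟨z, ?_, hzC, ?_⟩
    · rw [Finset.mem_union, Set.Finite.mem_toFinset]
      refine Or.inr fun i hi => ?_
      rcases lt_abs.1 hi with h | h
      · exact hz₂ i (by simp at h ⊢; omega)
      · exact hz₁ i (by simp at h ⊢; omega)
    · simpa using B'.add_mem hyB hzB

/-- The group of `ω` with `ω - shiftBy k ω ∈ B`. -/
noncomputable def translateQuotientFixed (k : ℤ) (B : AddSubgroup (ℤ →₀ V)) :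
    AddSubgroup (ℤ →₀ V) :=
  B.comap (AddMonoidHom.id _ - (shiftBy k).toAddMonoidHom)

theorem mem_translateQuotientFixed {k : ℤ} {B : AddSubgroup (ℤ →₀ V)} {ω : ℤ →₀ V} :
    ω ∈ translateQuotientFixed k B ↔ ω - shiftBy k ω ∈ B := Iff.rfl

theorem TranslateInvariant.le_translateQuotientFixed {k : ℤ} {B : AddSubgroup (ℤ →₀ V)}
    (hB : TranslateInvariant k B) : B ≤ translateQuotientFixed k B :=
  fun ω hω => B.sub_mem hω ((hB ω).2 hω)

theorem TranslateInvariant.translateQuotientFixed {k : ℤ} {B : AddSubgroup (ℤ →₀ V)}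
    (hB : TranslateInvariant k B) : TranslateInvariant k (translateQuotientFixed k B) := fun ω => by
  rw [mem_translateQuotientFixed, mem_translateQuotientFixed, ← map_sub, hB]

/-- `ω - shiftBy k ω` ends on the right exactly as `ω` does. On the left it starts `k` sites earlier
with the opposite sign, which translation by `-k` and negation repair. -/
theorem extremeValues_translateQuotientFixed_subset {k : ℕ} {B : AddSubgroup (ℤ →₀ V)}
    (hB : TranslateInvariant k B) :
    extremeValues k (translateQuotientFixed k B) ⊆ extremeValues k B := by
  rintro ⟨ε, s, a⟩ ⟨ω, hω, ha, h⟩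
  simp only at ha h
  have hk : 0 < k := s.pos
  rw [mem_translateQuotientFixed] at hω
  rcases Int.units_eq_one_or ε with rfl | rfl
  · refine ⟨_, hω, ?_, fun i hi => ?_⟩
    · simp only [Finsupp.sub_apply, shiftBy_apply, ha]
      rw [h _ (by simp; omega), sub_zero]
    · simp only [Units.val_one, one_mul] at hi h
      rw [Finsupp.sub_apply, shiftBy_apply, h _ hi, h _ (by omega), sub_zero]
  · have hω' := B.neg_mem (((hB.mul (-1)) _).2 hω)
    refine ⟨_, hω', ?_, fun i hi => ?_⟩
    · simp only [Finsupp.neg_apply, Finsupp.sub_apply, shiftBy_apply]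
      rw [h (_ + _) (by simp; omega)]
      simpa using ha
    · simp only [Units.val_neg, Units.val_one, neg_mul, one_mul] at hi h
      rw [Finsupp.neg_apply, shiftBy_apply, Finsupp.sub_apply, shiftBy_apply,
        h _ (by omega), h _ (by omega), sub_zero, neg_zero]

end Translation

/-! ### Subgroups outside the base leave at a finite stage. -/

namespace Lamplighter

open CantorBendixson

variable {n p : ℕ}

/-- The element `(u, q)` of the lamplighter group. -/
def mk (u : LampConfig n p) (q : ℤ) : Lamplighter n p := ⟨.ofAdd u, .ofAdd q⟩

theorem mk_mul_mk (u v : LampConfig n p) (q r : ℤ) :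
    mk u q * mk v r = mk (u + shiftBy q v) (q + r) := rfl

theorem exists_eq_mk (x : Lamplighter n p) : ∃ u q, x = mk u q := ⟨_, _, rfl⟩

theorem mk_eq_one : (mk 0 0 : Lamplighter n p) = 1 := rfl

theorem mk_inv (u : LampConfig n p) (q : ℤ) : (mk u q)⁻¹ = mk (-shiftBy (-q) u) (-q) := by
  rw [inv_eq_iff_mul_eq_one, mk_mul_mk, map_neg, shiftBy_shiftBy, add_neg_cancel, shiftBy_zero,
    add_neg_cancel, mk_eq_one]

theorem mk_inj {u v : LampConfig n p} {q r : ℤ} : mk u q = mk v r ↔ u = v ∧ q = r := by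
  constructor
  · intro h
    exact ⟨congrArg (fun x => x.left.toAdd) h, congrArg (fun x => x.right.toAdd) h⟩
  · rintro ⟨rfl, rfl⟩
    rfl

theorem mem_base_iff {u : LampConfig n p} {q : ℤ} : mk u q ∈ base n p ↔ q = 0 := by
  constructor
  · rintro ⟨w, hw⟩
    exact (congrArg (fun x : Lamplighter n p => x.right.toAdd) hw).symm
  · rintro rfl
    exact ⟨.ofAdd u, rfl⟩

/-- The configurations lying in a subgroup of the lamplighter group. -/
def configs (P : Subgroup (Lamplighter n p)) : AddSubgroup (LampConfig n p) where
  carrier := {u | mk u 0 ∈ P}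
  zero_mem' := P.one_mem
  add_mem' {a b} ha hb := by
    have := P.mul_mem ha hb
    rwa [mk_mul_mk, shiftBy_zero] at this
  neg_mem' {a} ha := by
    have := P.inv_mem ha
    rwa [mk_inv, neg_zero, shiftBy_zero] at this

theorem mem_configs {P : Subgroup (Lamplighter n p)} {u : LampConfig n p} :
    u ∈ configs P ↔ mk u 0 ∈ P := Iff.rfl

theorem translateInvariant_configs {P : Subgroup (Lamplighter n p)} {v : LampConfig n p} {k : ℤ}
    (hg : mk v k ∈ P) : TranslateInvariant k (configs P) := fun u => by
  have h : mk v k * mk u 0 = mk (shiftBy k u) 0 * mk v k := by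
    simp only [mk_mul_mk, shiftBy_zero, mk_inj]
    exact ⟨add_comm _ _, add_comm _ _⟩
  rw [mem_configs, mem_configs, ← P.mul_mem_cancel_right (x := mk v k) hg, ← h,
    P.mul_mem_cancel_left hg]

/-- Commutators lie in the base, as the quotient by it is abelian. For fixed `q` this is an affine
condition on `u`. -/
theorem commutator_mem_configs {P : Subgroup (Lamplighter n p)} {u v : LampConfig n p} {q k : ℤ}
    (hx : mk u q ∈ P) (hg : mk v k ∈ P) :
    u - shiftBy k u + (shiftBy q v - v) ∈ configs P := by
  have h := P.mul_mem (P.mul_mem hx hg) (P.inv_mem (P.mul_mem hg hx))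
  rw [mem_configs]
  convert h using 1
  rw [eq_mul_inv_iff_mul_eq]
  simp only [mk_mul_mk, shiftBy_zero, mk_inj]
  constructor
  · abel
  · ring

theorem mk_add_mem_iff {P : Subgroup (Lamplighter n p)} {u b : LampConfig n p} {q : ℤ}
    (hb : b ∈ configs P) : mk (b + u) q ∈ P ↔ mk u q ∈ P := by
  rw [← P.mul_mem_cancel_left (y := mk u q) hb, mk_mul_mk, shiftBy_zero, zero_add]

/-- Two subgroups with the same configurations and a common element outside the base are comparable
as soon as finitely many elements are. -/
theorem exists_finset_le [Finite (ZMod p)] {B : AddSubgroup (LampConfig n p)}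
    {v : LampConfig n p} {k : ℕ} (hk : 0 < k) (hB : TranslateInvariant k B) :
    ∃ F : Finset (Lamplighter n p), ∀ P Q : Subgroup (Lamplighter n p), configs P = B →
      configs Q = B → mk v k ∈ P → mk v k ∈ Q → (∀ x ∈ F, x ∈ P → x ∈ Q) → P ≤ Q := by
  classical
  obtain ⟨F, hF⟩ := exists_finite_reduction hk B
  have hred := (hF B fun _ _ h => h).2 hB _ hB.le_translateQuotientFixed hB.translateQuotientFixed
    (extremeValues_translateQuotientFixed_subset hB)
  have hsol : ∀ q : ℤ, ∃ u₀ : LampConfig n p, ∀ u : LampConfig n p,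
      u - shiftBy k u + (shiftBy q v - v) ∈ B → u - u₀ ∈ translateQuotientFixed k B := fun q => by
    -- The linear part is `1 - shiftBy k`, so one solution gives all of them modulo
    -- `translateQuotientFixed k B`; without solutions, `0` is a dummy.
    by_cases h : ∃ u₀ : LampConfig n p, u₀ - shiftBy k u₀ + (shiftBy q v - v) ∈ B
    · obtain ⟨u₀, hu₀⟩ := h
      refine ⟨u₀, fun u hu => ?_⟩
      have := B.sub_mem hu hu₀
      rw [mem_translateQuotientFixed, map_sub]
      convert this using 1
      abel
    · exact ⟨0, fun u hu => absurd ⟨u, hu⟩ h⟩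
  choose u₀ hu₀ using hsol
  refine ⟨((Finset.range k) ×ˢ F).image fun x => mk (x.2 + u₀ x.1) x.1,
    fun P Q hP hQ hgP hgQ h x hx => ?_⟩
  have hk' : (0 : ℤ) < k := by exact_mod_cast hk
  have key : ∀ u : LampConfig n p, ∀ q : ℕ, q < k → mk u q ∈ P → mk u q ∈ Q := by
    intro u q hq hu
    have hc := commutator_mem_configs hu hgP
    rw [hP] at hc
    obtain ⟨y, hyF, -, hy⟩ := hred _ (hu₀ q u hc)
    have hu' : u = (u - u₀ q - y) + (y + u₀ q) := by abel
    rw [hu'] at hu ⊢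
    rw [mk_add_mem_iff (by rwa [hP])] at hu
    rw [mk_add_mem_iff (by rwa [hQ])]
    refine h _ ?_ hu
    rw [Finset.mem_image]
    exact ⟨(q, y), by simp [hq, hyF], rfl⟩
  obtain ⟨u, q, rfl⟩ := exists_eq_mk x
  -- A power of the common element `mk v k` moves `q` into `0, …, k - 1`.
  obtain ⟨w, r, hwr⟩ := exists_eq_mk (mk v k ^ (-(q / k)))
  have hr : r = k * (-(q / k)) := by
    have := congrArg (fun x : Lamplighter n p => (SemidirectProduct.rightHom x).toAdd) hwr
    simp only [map_zpow, toAdd_zpow] at this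
    rw [mul_comm]
    exact this.symm
  have hrP := P.zpow_mem hgP (-(q / k))
  have hrQ := Q.zpow_mem hgQ (-(q / k))
  rw [hwr] at hrP hrQ
  rw [← P.mul_mem_cancel_left hrP, mk_mul_mk] at hx
  rw [← Q.mul_mem_cancel_left hrQ, mk_mul_mk]
  have hq : r + q = ((q % k).toNat : ℤ) := by
    have h0 := Int.emod_nonneg q hk'.ne'
    have := Int.emod_add_mul_ediv q k
    rw [mul_neg] at hr
    omega
  rw [hq] at hx ⊢
  refine key _ _ ?_ hx
  have h1 := Int.emod_lt_of_pos q hk'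
  omega

/-- Near a subgroup that is not contained in the base, all other subgroups have strictly more
extreme values. -/
theorem exists_finset_extremeValues_ssubset [Finite (ZMod p)] {H : Subgroup (Lamplighter n p)}
    {v : LampConfig n p} {k : ℕ} (hk : 0 < k) (hg : mk v k ∈ H) :
    ∃ F : Finset (Lamplighter n p), ∀ K : Subgroup (Lamplighter n p),
      (∀ x ∈ F, x ∈ K ↔ x ∈ H) → K ≠ H →
        mk v k ∈ K ∧ extremeValues k (configs H) ⊂ extremeValues k (configs K) := by
  classical
  have hH := translateInvariant_configs hg
  obtain ⟨F₁, hF₁⟩ := exists_finite_reduction hk (configs H)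
  obtain ⟨F₂, hF₂⟩ := exists_finset_le (v := v) hk hH
  refine ⟨{mk v k} ∪ F₁.image (fun u => mk u 0) ∪ F₂, fun K hK hne => ?_⟩
  have hgK : mk v k ∈ K := (hK _ (by simp)).2 hg
  have hKi := translateInvariant_configs hgK
  have h₁ : ∀ u ∈ F₁, u ∈ configs K ↔ u ∈ configs H := fun u hu =>
    hK _ (by simp only [Finset.mem_union, Finset.mem_image]; exact Or.inl (Or.inr ⟨u, hu, rfl⟩))
  have hsub := (hF₁ (configs K) fun u hu => (h₁ u hu).2).1
  refine ⟨hgK, hsub, fun hsup => hne ?_⟩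
  -- The intersection still contains the representatives for `H`, so both groups reduce modulo it.
  have hred := (hF₁ (configs K ⊓ configs H) fun u hu h => ⟨(h₁ u hu).2 h, h⟩).2 (hKi.inf hH)
  have heq : configs K = configs H := by
    apply le_antisymm
    · intro u hu
      obtain ⟨y, hyF, hy, hd⟩ := hred _ inf_le_left hKi hsup u hu
      simpa using (configs H).add_mem hd.2 ((h₁ y hyF).1 hy)
    · intro u hu
      obtain ⟨y, hyF, hy, hd⟩ := hred _ inf_le_right hH subset_rfl u hu
      simpa using (configs K).add_mem hd.1 ((h₁ y hyF).2 hy)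
  have h₂ : ∀ x ∈ F₂, x ∈ K ↔ x ∈ H := fun x hx => hK x (by simp [hx])
  exact le_antisymm (hF₂ K H heq rfl hgK hg fun x hx => (h₂ x hx).1)
    (hF₂ H K rfl heq hg hgK fun x hx => (h₂ x hx).2)

theorem notMem_iteratedDerivedSet_of_ncard_lt [Finite (ZMod p)] {v : LampConfig n p} {k : ℕ}
    (hk : 0 < k) (c : ℕ) (H : Subgroup (Lamplighter n p)) (hg : mk v k ∈ H)
    (hc : (extremeValues k (configs H))ᶜ.ncard < c) :
    H ∉ iteratedDerivedSet (Set.univ : Set (Subgroup (Lamplighter n p))) c := by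
  induction c generalizing H with
  | zero => omega
  | succ c ih =>
    rw [Nat.cast_succ, iteratedDerivedSet_succ]
    rintro ⟨hacc, -⟩
    rw [mem_derivedSet, Subgroup.accPt_principal_iff] at hacc
    obtain ⟨F, hF⟩ := exists_finset_extremeValues_ssubset hk hg
    obtain ⟨K, hK, hne, hKH⟩ := hacc F
    obtain ⟨hgK, hlt⟩ := hF K hKH hne
    refine ih K hgK ?_ hK
    have := Set.ncard_lt_ncard (compl_lt_compl_iff_lt.2 hlt) (Set.toFinite _)
    omega

theorem le_base_of_mem_iteratedDerivedSet [Finite (ZMod p)] {H : Subgroup (Lamplighter n p)}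
    (hH : ∀ c : ℕ, H ∈ iteratedDerivedSet (Set.univ : Set (Subgroup (Lamplighter n p))) c) :
    H ≤ base n p := by
  intro x hx
  obtain ⟨u, q, rfl⟩ := exists_eq_mk x
  rw [mem_base_iff]
  by_contra hq
  obtain ⟨v, k, hk, hg⟩ : ∃ (v : LampConfig n p) (k : ℕ), 0 < k ∧ mk v k ∈ H := by
    rcases lt_or_gt_of_ne hq with h | h
    · have := H.inv_mem hx
      rw [mk_inv] at this
      exact ⟨_, (-q).toNat, by omega, by rwa [Int.toNat_of_nonneg (by omega)]⟩
    · exact ⟨u, q.toNat, by omega, by rwa [Int.toNat_of_nonneg h.le]⟩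
  exact notMem_iteratedDerivedSet_of_ncard_lt hk _ H hg (Nat.lt_succ_self _) (hH _)

end Lamplighter

/-! ### Zero-sum groups. -/

/-- On the support of `u`, the fibres of `g` are unions of fibres of `f`. -/
theorem Finsupp.mapDomain_eq_zero_of_forall {α β γ M : Type*} [AddCommMonoid M] {f : α → β}
    {g : α → γ} {u : α →₀ M} (h : ∀ i ∈ u.support, ∀ j ∈ u.support, f i = f j → g i = g j)
    (hu : mapDomain f u = 0) : mapDomain g u = 0 := by
  classical
  rcases isEmpty_or_nonempty γ with hγ | ⟨⟨c⟩⟩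
  · have := Function.isEmpty g
    rw [Subsingleton.elim u 0, mapDomain_zero]
  have hfac : (fun i : u.support => g i).FactorsThrough fun i : u.support => f i :=
    fun i j hij => h i i.2 j j.2 hij
  have hcomp : mapDomain g u = mapDomain (Function.extend (fun i : u.support => f i)
      (fun i : u.support => g i) (fun _ => c) ∘ f) u :=
    mapDomain_congr fun i hi => (hfac.extend_apply (fun _ => c) ⟨i, hi⟩).symm
  rw [hcomp, mapDomain_comp, hu, mapDomain_zero]

section Classes

variable {V : Type*} [AddCommGroup V]

/-- The partition of `ℤ` refining congruence modulo `k`, in which the residue class `s` is cut into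
its classes modulo `k * N s`, hence into points when `N s = 0`. -/
def residueSetoid (k : ℕ) (N : ZMod k → ℕ) : Setoid ℤ where
  r i j := ((k * N i : ℕ) : ℤ) ∣ i - j
  iseqv := by
    have hcast : ∀ {i j : ℤ}, ((k * N i : ℕ) : ℤ) ∣ i - j → (i : ZMod k) = j := fun {i j} h => by
      rw [eq_comm, ZMod.intCast_eq_intCast_iff_dvd_sub]
      exact (Int.natCast_dvd_natCast.2 (Nat.dvd_mul_right k _)).trans h
    refine ⟨fun i => by simp, fun {i j} h => ?_, fun {i j l} h₁ h₂ => ?_⟩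
    · rw [← hcast h, ← neg_sub, dvd_neg]
      exact h
    · rw [← hcast h₁] at h₂
      simpa using dvd_add h₁ h₂

theorem mk_residueSetoid_eq_iff {k : ℕ} {N : ZMod k → ℕ} {i j : ℤ} :
    Quotient.mk (residueSetoid k N) i = Quotient.mk (residueSetoid k N) j ↔
      ((k * N i : ℕ) : ℤ) ∣ i - j := Quotient.eq

variable (V) in
/-- The configurations whose sum over each class of `residueSetoid k N` vanishes. -/
noncomputable def zeroSumConfigs (k : ℕ) (N : ZMod k → ℕ) : AddSubgroup (ℤ →₀ V) :=
  (Finsupp.mapDomain.addMonoidHom (Quotient.mk (residueSetoid k N))).ker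

theorem mem_zeroSumConfigs {k : ℕ} {N : ZMod k → ℕ} {ω : ℤ →₀ V} :
    ω ∈ zeroSumConfigs V k N ↔ ω.mapDomain (Quotient.mk (residueSetoid k N)) = 0 := Iff.rfl

theorem shiftBy_mul_mem_zeroSumConfigs {k : ℕ} {N : ZMod k → ℕ} {ω : ℤ →₀ V} (q : ℤ)
    (hω : ω ∈ zeroSumConfigs V k N) : shiftBy (k * q) ω ∈ zeroSumConfigs V k N := by
  have h : shiftBy (k * q) ω = ω.mapDomain (fun i => i - k * q) :=
    Finsupp.equivMapDomain_eq_mapDomain _ _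
  rw [mem_zeroSumConfigs, h, ← Finsupp.mapDomain_comp]
  refine Finsupp.mapDomain_eq_zero_of_forall (fun i _ j _ hij => ?_) (mem_zeroSumConfigs.1 hω)
  rw [mk_residueSetoid_eq_iff] at hij
  simpa [mk_residueSetoid_eq_iff] using hij

theorem translateInvariant_zeroSumConfigs (k : ℕ) (N : ZMod k → ℕ) :
    TranslateInvariant k (zeroSumConfigs V k N) := fun ω => by
  refine ⟨fun h => ?_, fun h => by simpa using shiftBy_mul_mem_zeroSumConfigs 1 h⟩
  simpa [shiftBy_shiftBy, shiftBy_zero] using shiftBy_mul_mem_zeroSumConfigs (-1) h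

theorem mem_zeroSumConfigs_update_iff {k : ℕ} [NeZero k] {N : ZMod k → ℕ} {s : ZMod k}
    (hs : N s = 0) {E : ℕ} {ω : ℤ →₀ V} (hω : ω ∈ windowed V E) :
    ω ∈ zeroSumConfigs V k (Function.update N s (2 * E + 1)) ↔ ω ∈ zeroSumConfigs V k N := by
  have hsupp : ∀ i ∈ ω.support, |i| ≤ E := fun i hi => by
    by_contra h
    exact Finsupp.mem_support_iff.1 hi (hω i (not_le.1 h))
  constructor <;> intro h <;>
    refine Finsupp.mapDomain_eq_zero_of_forall (fun i hi j hj hij => ?_) h <;>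
    rw [mk_residueSetoid_eq_iff] at hij ⊢ <;> by_cases his : (i : ZMod k) = s
  · have hi' := abs_le.1 (hsupp i hi)
    have hj' := abs_le.1 (hsupp j hj)
    rw [his, Function.update_self] at hij
    -- Two points of `[-E, E]` differ by at most `2 * E`, less than the modulus.
    have : i - j = 0 := by
      refine Int.eq_zero_of_abs_lt_dvd ((Int.natCast_dvd_natCast.2 (Nat.dvd_mul_left _ k)).trans hij)
        ?_
      rw [abs_lt]
      push_cast
      omega
    simp [this]
  · rwa [Function.update_of_ne his] at hij
  · rw [his, hs] at hij
    rw [show i - j = 0 by simpa using hij]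
    exact dvd_zero _
  · rwa [Function.update_of_ne his]

theorem zeroSumConfigs_update_ne [Nontrivial V] {k : ℕ} [NeZero k] {N : ZMod k → ℕ} {s : ZMod k}
    (hs : N s = 0) {m : ℕ} (hm : m ≠ 0) :
    zeroSumConfigs V k (Function.update N s m) ≠ zeroSumConfigs V k N := by
  obtain ⟨a, ha⟩ := exists_ne (0 : V)
  obtain ⟨i, rfl⟩ := ZMod.intCast_surjective s
  intro h
  have hmem := SetLike.ext_iff.1 h
    (Finsupp.single i a - Finsupp.single (i + (k * m : ℕ)) a)
  simp only [mem_zeroSumConfigs, sub_eq_add_neg, ← Finsupp.single_neg, Finsupp.mapDomain_add,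
    Finsupp.mapDomain_single] at hmem
  simp only [Finsupp.single_neg, ← sub_eq_add_neg, sub_eq_zero, Finsupp.single_left_inj ha,
    mk_residueSetoid_eq_iff, Function.update_self, hs] at hmem
  have := hmem.1 (by simp)
  simp [hm, NeZero.ne k] at this

end Classes

/-! ### Survivors of the derivatives. -/

namespace Lamplighter

open CantorBendixson

variable {n p : ℕ}

/-- The semidirect product of an invariant group of configurations with `kℤ`. -/
def extension (B : AddSubgroup (LampConfig n p)) (k : ℤ) (hB : TranslateInvariant k B) :
    Subgroup (Lamplighter n p) where
  carrier := {x | x.left.toAdd ∈ B ∧ k ∣ x.right.toAdd}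
  one_mem' := ⟨B.zero_mem, dvd_zero k⟩
  mul_mem' {x y} hx hy := by
    obtain ⟨u, q, rfl⟩ := exists_eq_mk x
    obtain ⟨v, r, rfl⟩ := exists_eq_mk y
    obtain ⟨hu, q, rfl⟩ := hx
    obtain ⟨hv, hr⟩ := hy
    exact ⟨B.add_mem hu ((hB.mul q _).2 hv), dvd_add (dvd_mul_right k q) hr⟩
  inv_mem' {x} hx := by
    obtain ⟨u, q, rfl⟩ := exists_eq_mk x
    obtain ⟨hu, q, rfl⟩ := hx
    rw [mk_inv]
    refine ⟨B.neg_mem ?_, dvd_neg.2 (dvd_mul_right k q)⟩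
    have := (hB.mul (-q) u).2 hu
    rwa [mul_neg] at this

theorem mk_mem_extension {B : AddSubgroup (LampConfig n p)} {k : ℤ} {hB : TranslateInvariant k B}
    {u : LampConfig n p} {q : ℤ} : mk u q ∈ extension B k hB ↔ u ∈ B ∧ k ∣ q := Iff.rfl

theorem configs_extension {B : AddSubgroup (LampConfig n p)} {k : ℤ}
    {hB : TranslateInvariant k B} : configs (extension B k hB) = B := by
  ext u
  simp [mem_configs, mk_mem_extension]

theorem exists_forall_left_mem_windowed (F : Finset (Lamplighter n p)) :
    ∃ E, ∀ x ∈ F, x.left.toAdd ∈ windowed (Fin n → ZMod p) E := by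
  classical
  obtain ⟨E, hE⟩ := exists_forall_mem_windowed (F.image fun x => x.left.toAdd)
  exact ⟨E, fun x hx => hE _ (Finset.mem_image_of_mem _ hx)⟩

theorem extension_zeroSumConfigs_mem_iteratedDerivedSet [Nontrivial (Fin n → ZMod p)] {k : ℕ}
    [NeZero k] (m : ℕ) (N : ZMod k → ℕ) (hm : m ≤ (Finset.univ.filter fun s => N s = 0).card) :
    extension (zeroSumConfigs (Fin n → ZMod p) k N) k (translateInvariant_zeroSumConfigs k N) ∈
      iteratedDerivedSet (Set.univ : Set (Subgroup (Lamplighter n p))) m := by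
  classical
  induction m generalizing N with
  | zero => simp
  | succ m ih =>
    rw [Nat.cast_succ, iteratedDerivedSet_succ]
    refine ⟨?_, ih N (by omega)⟩
    rw [mem_derivedSet, Subgroup.accPt_principal_iff]
    intro F
    obtain ⟨E, hE⟩ := exists_forall_left_mem_windowed F
    obtain ⟨s, hs⟩ := Finset.card_pos.1 (show 0 < _ from lt_of_lt_of_le m.succ_pos hm)
    have hs' : N s = 0 := (Finset.mem_filter.1 hs).2
    -- The approximation spends the class `s` and leaves the other zeros of `N` available.
    refine ⟨_, ih (Function.update N s (2 * E + 1)) ?_, fun h => ?_, fun x hx => ?_⟩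
    · refine le_trans ?_ (Finset.card_le_card (s := (Finset.univ.filter fun s => N s = 0).erase s)
        fun t ht => ?_)
      · rw [Finset.card_erase_of_mem hs]
        omega
      · obtain ⟨hts, ht⟩ := Finset.mem_erase.1 ht
        simpa [Function.update_of_ne hts] using ht
    · refine zeroSumConfigs_update_ne (V := Fin n → ZMod p) hs' (Nat.succ_ne_zero (2 * E)) ?_
      have := congrArg configs h
      rwa [configs_extension, configs_extension] at this
    · obtain ⟨u, q, rfl⟩ := exists_eq_mk x
      rw [mk_mem_extension, mk_mem_extension, mem_zeroSumConfigs_update_iff (ω := u) hs' (hE _ hx)]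

theorem exists_mem_iteratedDerivedSet_not_le_base [Nontrivial (Fin n → ZMod p)] (m : ℕ) :
    ∃ H ∈ iteratedDerivedSet (Set.univ : Set (Subgroup (Lamplighter n p))) m, ¬ H ≤ base n p := by
  -- Here `m` classes would do; `m + 1` keeps the modulus nonzero when `m = 0`.
  refine ⟨_, extension_zeroSumConfigs_mem_iteratedDerivedSet (k := m + 1) m 0 ?_, fun h => ?_⟩
  · simp [ZMod.card]
  · have := h (x := mk 0 (m + 1 : ℕ)) (mk_mem_extension.2 ⟨AddSubgroup.zero_mem _, dvd_rfl⟩)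
    rw [mem_base_iff] at this
    omega

theorem translateInvariant_zero (B : AddSubgroup (LampConfig n p)) : TranslateInvariant 0 B :=
  fun ω => by rw [shiftBy_zero]

theorem preperfect_subgroups_of_base [Nontrivial (Fin n → ZMod p)] :
    Preperfect {H : Subgroup (Lamplighter n p) | H ≤ base n p} := by
  intro H hH
  rw [Subgroup.accPt_principal_iff]
  intro F
  obtain ⟨E, hE⟩ := exists_forall_left_mem_windowed F
  suffices h : ∃ B : AddSubgroup (LampConfig n p), B ≠ configs H ∧
      ∀ u ∈ windowed (Fin n → ZMod p) E, u ∈ B ↔ u ∈ configs H by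
    obtain ⟨B, hne, hB⟩ := h
    refine ⟨extension B 0 (translateInvariant_zero B), fun x hx => ?_, fun h => hne ?_,
      fun x hx => ?_⟩
    · obtain ⟨u, q, rfl⟩ := exists_eq_mk x
      exact mem_base_iff.2 (zero_dvd_iff.1 hx.2)
    · rw [← h, configs_extension]
    · have hxE := hE x hx
      obtain ⟨u, q, rfl⟩ := exists_eq_mk x
      rw [mk_mem_extension, hB u hxE, zero_dvd_iff]
      constructor
      · rintro ⟨h, rfl⟩
        exact h
      · intro h
        obtain rfl := mem_base_iff.1 (hH h)
        exact ⟨h, rfl⟩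
  -- If `configs H` leaves the window, cut it down to the window; otherwise enlarge it by everything
  -- supported outside.
  by_cases hne : configs H ⊓ windowed (Fin n → ZMod p) E = configs H
  · obtain ⟨a, ha⟩ := exists_ne (0 : Fin n → ZMod p)
    refine ⟨(configs H).comap (Finsupp.filterAddHom fun i : ℤ => |i| ≤ E), fun h => ?_,
      fun u hu => ?_⟩
    · have hmem : Finsupp.single (E + 1 : ℤ) a ∈
          (configs H).comap (Finsupp.filterAddHom fun i : ℤ => |i| ≤ E) := by
        rw [AddSubgroup.mem_comap]
        convert (configs H).zero_mem
        refine Finsupp.filter_single_of_neg _ ?_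
        rw [not_le, lt_abs]
        omega
      rw [h, ← hne] at hmem
      have := hmem.2 (E + 1) (by rw [lt_abs]; omega)
      rw [Finsupp.single_eq_same] at this
      exact ha this
    · rw [AddSubgroup.mem_comap]
      have : Finsupp.filterAddHom (fun i : ℤ => |i| ≤ E) u = u :=
        (Finsupp.filter_eq_self_iff _ _).2 fun i hi => by
          by_contra h
          exact hi (hu i (not_le.1 h))
      rw [this]
  · exact ⟨_, hne, fun u hu => ⟨fun h => h.1, fun h => ⟨h, hu⟩⟩⟩

theorem iteratedDerivedSet_omega0 [Finite (ZMod p)] [Nontrivial (Fin n → ZMod p)] :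
    iteratedDerivedSet (Set.univ : Set (Subgroup (Lamplighter n p))) Ordinal.omega0 =
      {H | H ≤ base n p} := by
  apply Set.Subset.antisymm
  · intro H hH
    exact le_base_of_mem_iteratedDerivedSet fun c =>
      iteratedDerivedSet_antitone _ (Ordinal.natCast_lt_omega0 c).le hH
  · rw [← iteratedDerivedSet_constant_iff_preperfect.1
      (preperfect_subgroups_of_base (n := n) (p := p)) Ordinal.omega0]
    exact iteratedDerivedSet_mono (Set.subset_univ _) _

end Lamplighter

theorem theorem1 (n p : ℕ) (hn : 1 ≤ n) (hp : p.Prime) :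
    CantorBendixson.perfectKernel (Set.univ : Set (Subgroup (Lamplighter n p))) =
        {H : Subgroup (Lamplighter n p) | H ≤ Lamplighter.base n p} ∧
      cantorBendixsonRank (Subgroup (Lamplighter n p)) = Ordinal.omega0 := by
  have : Fact p.Prime := ⟨hp⟩
  have : NeZero n := ⟨by omega⟩
  have hω := Lamplighter.iteratedDerivedSet_omega0 (n := n) (p := p)
  have hker : CantorBendixson.perfectKernel (Set.univ : Set (Subgroup (Lamplighter n p))) =
      {H : Subgroup (Lamplighter n p) | H ≤ Lamplighter.base n p} := by
    rw [← hω]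
    refine CantorBendixson.perfectKernel_eq_iteratedDerivedSet_of_mem_fixedPoints ?_
    rw [hω]
    exact (preperfect_iff_eq_relDerivedSet.1 Lamplighter.preperfect_subgroups_of_base).symm
  refine ⟨hker, le_antisymm ?_ ?_⟩
  · refine (isLeast_cantorBendixsonRank _).2 fun b hb => ?_
    refine (CantorBendixson.iteratedDerivedSet_antitone _ hb).antisymm ?_
    rw [hω, ← hker]
    exact CantorBendixson.perfectKernel_subset_iteratedDerivedSet _ b
  · by_contra h
    obtain ⟨m, hm⟩ := Ordinal.lt_omega0.1 (not_le.1 h)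
    obtain ⟨H, hH, hHb⟩ :=
      Lamplighter.exists_mem_iteratedDerivedSet_not_le_base (n := n) (p := p) m
    have := (isLeast_cantorBendixsonRank (Subgroup (Lamplighter n p))).1 _ (not_le.1 h).le
    rw [← hm, ← this, hω] at hH
    exact hHb hH
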